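/- Let $\mathcal X$ (states), $\mathcal F$ (frames) and $\mathcal A_k$ (actions of decision problem $k$) be finite sets, $\mu$ a probability distribution on $\mathcal X$ (the prior), $\nu$ a probability distribution on $\mathcal F$ (a single fixed frame is the case of a point mass), and $u:\mathcal X\times\mathcal A_k\times\mathcal F\to\mathbb R$ a utility function. A policy $\pi$ assigns to every $(x,f)$ a probability distribution $\pi(\cdot|x,f)$ on $\mathcal A_k$; its net utility is $$V(\pi)=\sum_{f\in\mathcal F}\nu(f)\sum_{x\in\mathcal X}\sum_{a\in\mathcal A_k}\pi(a|x,f)\,\mu(x)\,u(x,a,f).$$ Let $\hat\pi_k$ be a fixed policy (the observed policy) and $\Pi$ an arbitrary non-empty set of policies such that $\pi_k(a|x,f)=0$ whenever $\pi_k\in\Pi$ and $\hat\pi_k(a|x,f)=0$. For $\pi_k\in\Pi$ define the importance weighted utility $$\bar u(\pi_k)(x,f,a)=\frac{\pi_k(a|x,f)}{\hat\pi_k(a|x,f)}\,u(x,a,f)\qquad(\text{with } 0/0=0),$$ let $M>0$ be a constant such that $M\bar u(\pi_k)$ takes values in $[0,1]$ for every $\pi_k\in\Pi$, and let $\mathcal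 F_\Pi=\{M\bar u(\pi_k):\pi_k\in\Pi\}$. For a class $G$ of functions $g:Z\to[0,1]$, $\varepsilon>0$ and $m\in\mathbb N$, let the uniform covering number $\mathcal N_\infty(\varepsilon,G,m)$ be the supremum over $z\in Z^m$ of the smallest number of points of $G(z)=\{(g(z_1),\dots,g(z_m)):g\in G\}\subset\mathbb R^m$ such that every point of $G(z)$ is within $\ell_\infty$-distance $\varepsilon$ of one of them. Let $T_k\ge 16$, let $(x_t,f_t,a_t)$, $t=1,\dots,T_k$, be i.i.d. with $\Pr(x_t=x,f_t=f,a_t=a)=\mu(x)\,\nu(f)\,\hat\pi_k(a|x,f)$, and let $\gamma\in(0,1)$. Put $\bar u_t(\pi_k)=\bar u(\pi_k)(x_t,f_t,a_t)$, $$\hat V(\pi_k)=\frac1{T_k}\sum_{t=1}^{T_k}\bar u_t(\pi_k),\qquad \operatorname{Var}[\bar u(\pi_k)]=\frac1{T_k-1}\sum_{t=1}^{T_k}\bigl(\bar u_t(\pi_k)-\hat V(\pi_k)\bigr)^2,$$ $$\lambda=\sqrt{18\ln\bigl(10\,\mathcal N_\infty(1/T_k,\mathcal F_\Pi,2T_k)/\gamma\bigr)}.$$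 Then, with probability at least $1-\gamma$, simultaneously for all $\pi_k\in\Pi$, $$V(\pi_k)\le\hat V(\pi_k)+\lambda\sqrt{\frac{\operatorname{Var}[\bar u(\pi_k)]}{T_k}}+\frac{15\lambda^2}{18M(T_k-1)}.$$ -/

import Mathlib

open MeasureTheory ProbabilityTheory
open scoped NNReal

noncomputable section

/-! `X` is the finite set of states, `F` the finite set of frames, `A` the finite set of actions
of one decision problem. -/

/-- A (randomized) action-selection policy `π(a | x, f)`: for every state `x` and frame `f` a
probability distribution on the actions. -/
abbrev Policy (X F A : Type*) := X → F → PMF A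

/-- The probability `π(a | x, f)` as a real number. -/
def Policy.prob {X F A : Type*} (π : Policy X F A) (x : X) (f : F) (a : A) : ℝ :=
  (π x f a).toReal

/-- The net utility `∑ x, ∑ a, π(a | x, f) μ(x) u(x, a, f)` of the policy `π` in the frame `f`,
for states with prior `μ`. -/
def netUtilityInFrame {X F A : Type*} [Fintype X] [Fintype A]
    (μ : PMF X) (u : X → A → F → ℝ) (π : Policy X F A) (f : F) : ℝ :=
  ∑ x : X, ∑ a : A, π.prob x f a * (μ x).toReal * u x a f

/-- The net utility `V(π)` of the policy `π` when frames have distribution `ν` (a single fixed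
frame `f` is the case `ν = PMF.pure f`). -/
def netUtility {X F A : Type*} [Fintype X] [Fintype F] [Fintype A]
    (μ : PMF X) (ν : PMF F) (u : X → A → F → ℝ) (π : Policy X F A) : ℝ :=
  ∑ f : F, (ν f).toReal * netUtilityInFrame μ u π f

/-- The law of one observation `(x, f, a)`: state `x ∼ μ`, frame `f ∼ ν`, and action
`a ∼ π₀(· | x, f)`, where `π₀` is the observed policy. -/
def observationLaw {X F A : Type*} (μ : PMF X) (ν : PMF F) (π₀ : Policy X F A) :
    PMF (X × F × A) :=
  μ.bind fun x => ν.bind fun f => (π₀ x f).map fun a => (x, f, a)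

/-- The importance weighted utility `ū(π) = (π(a | x, f) / π₀(a | x, f)) u(x, a, f)` of the policy
`π` at the observation `(x, f, a)`, relative to the observed policy `π₀`. -/
def weightedUtility {X F A : Type*} (u : X → A → F → ℝ) (π₀ π : Policy X F A)
    (z : X × F × A) : ℝ :=
  π.prob z.1 z.2.1 z.2.2 / π₀.prob z.1 z.2.1 z.2.2 * u z.1 z.2.2 z.2.1

/-- The class of functions `M ū(π)`, where `π` runs through the hypothesis class `H`. -/
def utilityClass {X F A : Type*} (M : ℝ) (u : X → A → F → ℝ) (π₀ : Policy X F A)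
    (H : Set (Policy X F A)) : Set (X × F × A → ℝ) :=
  {g | ∃ π ∈ H, g = fun z => M * weightedUtility u π₀ π z}

/-- The uniform covering number `𝒩_∞(ε, G, m)` of a class `G` of real functions on `Z`: the
supremum over `m`-tuples `z` of points of `Z` of the smallest cardinality of an `ε`-cover, by
points of the set itself and in the maximum norm, of the set
`{(g z₁, …, g z_m) | g ∈ G}` in `ℝ ^ m`. -/
def uniformCoveringNumber {Z : Type*} (ε : ℝ≥0) (G : Set (Z → ℝ)) (m : ℕ) : ℕ∞ :=
  ⨆ z : Fin m → Z, Metric.coveringNumber ε ((fun g : Z → ℝ => fun i => g (z i)) '' G)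

/-- For a class of functions with values in `[0, 1]` on a finite set the uniform covering numbers
are finite. -/
theorem uniformCoveringNumber_ne_top {Z : Type*} [Finite Z] {ε : ℝ≥0} (hε : 0 < ε)
    {G : Set (Z → ℝ)} (hG : ∀ g ∈ G, ∀ z, g z ∈ Set.Icc (0 : ℝ) 1) (m : ℕ) :
    uniformCoveringNumber ε G m ≠ ⊤ := by
  have key : ∀ z : Fin m → Z,
      Metric.coveringNumber ε ((fun g : Z → ℝ => fun i => g (z i)) '' G) < ⊤ := by
    intro z
    have hsub : (fun g : Z → ℝ => fun i => g (z i)) '' G ⊆ Set.Icc (0 : Fin m → ℝ) 1 := by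
      rintro _ ⟨g, hg, rfl⟩
      exact ⟨fun i => (hG g hg (z i)).1, fun i => (hG g hg (z i)).2⟩
    have htb : TotallyBounded ((fun g : Z → ℝ => fun i => g (z i)) '' G) :=
      isCompact_Icc.totallyBounded.subset hsub
    obtain ⟨t, hts, htf, ht⟩ := totallyBounded_iff_subset.1 htb
      {p | dist p.1 p.2 < ε} (Metric.dist_mem_uniformity (by exact_mod_cast hε))
    refine lt_of_le_of_lt (Metric.IsCover.coveringNumber_le_encard hts ?_) htf.encard_lt_top
    intro y hy
    obtain ⟨c, hc, hyc⟩ := Set.mem_iUnion₂.1 (ht hy)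
    refine ⟨c, hc, ?_⟩
    change edist y c ≤ ε
    rw [edist_nndist]
    exact_mod_cast (show dist y c < ε from hyc).le
  have := Fintype.ofFinite Z
  unfold uniformCoveringNumber
  rw [← Finset.sup_univ_eq_iSup]
  exact ((Finset.sup_lt_iff (by simp)).2 fun z _ => key z).ne

/-- The mean of the `T` numbers `v`. -/
def sampleMean {T : ℕ} (v : Fin T → ℝ) : ℝ := (∑ t, v t) / T

/-- The (unbiased) sample variance of the `T` numbers `v`. -/
def sampleVariance {T : ℕ} (v : Fin T → ℝ) : ℝ := (∑ t, (v t - sampleMean v) ^ 2) / (T - 1)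

/-- The coefficient `λ = √(18 ln (10 𝒩_∞(1 / T, G, 2 T) / γ))`. -/
def confidenceCoeff {Z : Type*} (G : Set (Z → ℝ)) (T : ℕ) (γ : ℝ) : ℝ :=
  √(18 * Real.log (10 * ((uniformCoveringNumber (1 / (T : ℝ≥0)) G (2 * T)).toNat : ℝ) / γ))

end

/-! Importance weighting is unbiased (`integral_weightedUtility`), so after scaling by `M` the claim
is an empirical Bernstein bound, uniform over a class of `[0, 1]`-valued functions
(`measureReal_exists_gt_empirical_bernstein_le`).

That bound comes from a second, independent sample. If some `g` violates it on the first sample,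
then with probability at least `3 / 10` the second sample exposes this: its sum nearly reaches `n ∫
g` (`integral_le_sum_add_sqrt_sumSqDev`). The law of the pair is invariant under exchanging `i`-th
entries, so it suffices to count bad exchanges for a fixed pair. Only `2 n` points then matter, and
a cover with at most `N` elements replaces the class. For one function, both the difference of the
sums and the difference of the squared deviations are Rademacher sums. Hoeffding controls the former
by the pooled deviation, and the latter lets the first sample's deviation replace the pooled one
(`card_swapPairs_deviation_le`).

With `r ^ 2 = ln (10 N / γ)` and `λ = √18 r`, the three tails over the cover total `3 N exp (-r ^ 2)
= 3 γ / 10`; dividing by `3 / 10` leaves `γ`. -/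

/-! ### Sums of squared deviations -/

/-- The sum of the squared deviations of the numbers `v` from their mean. -/
noncomputable def sumSqDev {n : ℕ} (v : Fin n → ℝ) : ℝ := ∑ i, (v i - sampleMean v) ^ 2

theorem sumSqDev_nonneg {n : ℕ} (v : Fin n → ℝ) : 0 ≤ sumSqDev v :=
  Finset.sum_nonneg fun _ _ => sq_nonneg _

theorem sum_sq_sub_eq {n : ℕ} (hn : n ≠ 0) (v : Fin n → ℝ) (c : ℝ) :
    ∑ i, (v i - c) ^ 2 = sumSqDev v + n * (sampleMean v - c) ^ 2 := by
  have hn' : (n : ℝ) ≠ 0 := by exact_mod_cast hn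
  have h0 : ∑ i, (v i - sampleMean v) = 0 := by
    rw [Finset.sum_sub_distrib]
    simp [sampleMean]
    field_simp
    simp
  have h1 : ∀ i, (v i - c) ^ 2 = (v i - sampleMean v) ^ 2
      + 2 * (sampleMean v - c) * (v i - sampleMean v) + (sampleMean v - c) ^ 2 := fun i => by ring
  simp_rw [h1]
  rw [Finset.sum_add_distrib, Finset.sum_add_distrib, ← Finset.mul_sum, h0]
  simp [sumSqDev]

theorem sumSqDev_le_sum_sq {n : ℕ} (v : Fin n → ℝ) : sumSqDev v ≤ ∑ i, v i ^ 2 := by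
  rcases Nat.eq_zero_or_pos n with rfl | hn
  · simp [sumSqDev]
  · have := sum_sq_sub_eq hn.ne' v 0
    simp only [sub_zero] at this
    rw [this]
    have : 0 ≤ (n : ℝ) * sampleMean v ^ 2 := by positivity
    linarith

theorem sqrt_sum_sq_add_le {n : ℕ} (a b : Fin n → ℝ) :
    √(∑ i, (a i + b i) ^ 2) ≤ √(∑ i, a i ^ 2) + √(∑ i, b i ^ 2) := by
  have := norm_add_le (WithLp.toLp 2 a : EuclideanSpace ℝ (Fin n)) (WithLp.toLp 2 b)
  simpa [EuclideanSpace.norm_eq] using this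

/-- The root is the Euclidean norm of the centred vector, hence a seminorm, and centring does not
increase the norm of `v - w`. -/
theorem sqrt_sumSqDev_le_add {n : ℕ} {v w : Fin n → ℝ} {δ : ℝ} (hδ : 0 ≤ δ)
    (h : ∀ i, |v i - w i| ≤ δ) : √(sumSqDev v) ≤ √(sumSqDev w) + √n * δ := by
  have hmean : sampleMean v = sampleMean w + sampleMean (fun i => v i - w i) := by
    simp only [sampleMean, Finset.sum_sub_distrib]
    ring
  have h1 : sumSqDev v = ∑ i, ((w i - sampleMean w)
      + ((v i - w i) - sampleMean (fun i => v i - w i))) ^ 2 := by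
    refine Finset.sum_congr rfl fun i _ => ?_
    rw [hmean]
    ring
  have h2 : sumSqDev (fun i => v i - w i) ≤ n * δ ^ 2 := by
    refine (sumSqDev_le_sum_sq _).trans ?_
    calc ∑ i, (v i - w i) ^ 2 ≤ ∑ _i : Fin n, δ ^ 2 :=
          Finset.sum_le_sum fun i _ => sq_le_sq' (abs_le.1 (h i)).1 (abs_le.1 (h i)).2
      _ = n * δ ^ 2 := by simp
  rw [h1]
  refine (sqrt_sum_sq_add_le _ _).trans ?_
  gcongr
  · exact le_rfl
  · refine (Real.sqrt_le_sqrt h2).trans ?_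
    rw [Real.sqrt_mul (by positivity), Real.sqrt_sq hδ]

/-! ### Rademacher sums -/

/-- The sign `±1` attached to a bit. -/
def boolSign (b : Bool) : ℝ := bif b then -1 else 1

theorem sum_exp_rademacher_le {n : ℕ} (c : Fin n → ℝ) (l : ℝ) :
    ∑ σ : Fin n → Bool, Real.exp (l * ∑ i, boolSign (σ i) * c i)
      ≤ 2 ^ n * Real.exp (l ^ 2 * (∑ i, c i ^ 2) / 2) := by
  have h1 : ∀ σ : Fin n → Bool, Real.exp (l * ∑ i, boolSign (σ i) * c i)
      = ∏ i, Real.exp (l * (boolSign (σ i) * c i)) := fun σ => by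
    rw [← Real.exp_sum, Finset.mul_sum]
  simp_rw [h1]
  have h2 := Finset.prod_univ_sum (fun _ : Fin n => (Finset.univ : Finset Bool))
    (fun i b => Real.exp (l * (boolSign b * c i)))
  rw [Fintype.piFinset_univ] at h2
  rw [← h2]
  calc ∏ i, ∑ b : Bool, Real.exp (l * (boolSign b * c i))
      ≤ ∏ i, (2 * Real.exp ((l * c i) ^ 2 / 2)) := by
        refine Finset.prod_le_prod (fun i _ => by positivity) fun i _ => ?_
        have := Real.cosh_le_exp_half_sq (l * c i)
        rw [Real.cosh_eq] at this
        simp only [Fintype.sum_bool, boolSign, cond_true, cond_false, one_mul, neg_mul, mul_neg]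
        linarith
    _ = 2 ^ n * Real.exp (l ^ 2 * (∑ i, c i ^ 2) / 2) := by
        rw [Finset.prod_mul_distrib, ← Real.exp_sum]
        simp only [Finset.prod_const, Finset.card_univ, Fintype.card_fin]
        congr 2
        rw [Finset.mul_sum, Finset.sum_div]
        exact Finset.sum_congr rfl fun i _ => by ring

/-- Hoeffding's inequality for Rademacher sums. -/
theorem card_rademacher_tail_le {n : ℕ} (c : Fin n → ℝ) {r b : ℝ} (hr : 0 ≤ r) (hb : 0 ≤ b)
    (hc : ∑ i, c i ^ 2 ≤ b ^ 2) :
    (Nat.card {σ : Fin n → Bool // √2 * r * b < ∑ i, boolSign (σ i) * c i} : ℝ)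
      ≤ 2 ^ n * Real.exp (-r ^ 2) := by
  classical
  rw [Nat.card_eq_fintype_card, Fintype.card_subtype]
  -- For `b = 0` all `c i` vanish and the strict inequality makes the event empty.
  rcases hb.eq_or_lt with rfl | hb
  · have h0 : ∀ i, c i = 0 := fun i => by
      have h1 : c i ^ 2 ≤ ∑ i, c i ^ 2 :=
        Finset.single_le_sum (fun j _ => sq_nonneg (c j)) (Finset.mem_univ i)
      exact pow_eq_zero_iff (two_ne_zero) |>.1 (le_antisymm (by linarith) (sq_nonneg _))
    simp [h0]
    positivity
  set S := Finset.univ.filter fun σ : Fin n → Bool => √2 * r * b < ∑ i, boolSign (σ i) * c i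
  have h2 : √2 ^ 2 = 2 := Real.sq_sqrt (by norm_num)
  -- The minimizer of the Chernoff exponent `l ^ 2 * b ^ 2 / 2 - l * (√2 * r * b)`, with minimum `-r
  -- ^ 2`.
  set l := √2 * r / b
  have hl : 0 ≤ l := by positivity
  have hS : (S.card : ℝ) * Real.exp (l * (√2 * r * b)) ≤ 2 ^ n * Real.exp (l ^ 2 * b ^ 2 / 2) := by
    calc (S.card : ℝ) * Real.exp (l * (√2 * r * b))
        = ∑ _σ ∈ S, Real.exp (l * (√2 * r * b)) := by simp
      _ ≤ ∑ σ ∈ S, Real.exp (l * ∑ i, boolSign (σ i) * c i) := by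
          refine Finset.sum_le_sum fun σ hσ => Real.exp_le_exp.2 ?_
          exact mul_le_mul_of_nonneg_left (Finset.mem_filter.1 hσ).2.le hl
      _ ≤ ∑ σ : Fin n → Bool, Real.exp (l * ∑ i, boolSign (σ i) * c i) :=
          Finset.sum_le_univ_sum_of_nonneg fun _ => (Real.exp_pos _).le
      _ ≤ _ := sum_exp_rademacher_le c l
      _ ≤ _ := by gcongr
  have e1 : l * (√2 * r * b) = 2 * r ^ 2 := by
    simp only [l]; field_simp; rw [h2]; ring
  have e2 : l ^ 2 * b ^ 2 / 2 = r ^ 2 := by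
    simp only [l]; field_simp; rw [h2]; ring
  rw [e1, e2] at hS
  have e3 : Real.exp (2 * r ^ 2) = Real.exp (r ^ 2) * Real.exp (r ^ 2) := by
    rw [← Real.exp_add]; ring_nf
  rw [Real.exp_neg]
  have hp := Real.exp_pos (r ^ 2)
  rw [← div_eq_mul_inv, le_div_iff₀ hp]
  rw [e3, ← mul_assoc] at hS
  exact le_of_mul_le_mul_right hS hp

/-! ### Random exchanges of the entries of two samples -/

/-- Exchange of the `i`-th entries of two samples for those `i` with `σ i = true`. -/
def swapPairs {n : ℕ} {Z : Type*} (σ : Fin n → Bool) (p : (Fin n → Z) × (Fin n → Z)) :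
    (Fin n → Z) × (Fin n → Z) :=
  (fun i => bif σ i then p.2 i else p.1 i, fun i => bif σ i then p.1 i else p.2 i)

/-- The deterministic part of the exchange argument: `h1`, `h1'`, `h2` say that none of the three
Rademacher tails occurs, `s` and `s'` are the deviations of the two samples, and `w` is the pooled
deviation. -/
theorem swap_deviation_bound {n r s s' w D : ℝ} (hr : 0 ≤ r) (hr2 : 2.3 ≤ r ^ 2)
    (hn : 15 * r ^ 2 ≤ n) (hs : 0 ≤ s) (hw : 0 ≤ w)
    (h1 : D ≤ 2 * r * w) (h1' : -D ≤ 2 * r * w) (h2 : s' ^ 2 - s ^ 2 ≤ √2 * r * w)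
    (h3 : w ^ 2 = s ^ 2 + s' ^ 2 + D ^ 2 / (2 * n)) :
    D + 1.26 * s' + 10.5 ≤ √18 * r * s + 15 * r ^ 2 := by
  have hn0 : 0 < n := by linarith
  have hr1 : 1.5 ≤ r := by nlinarith
  have hD : D ^ 2 ≤ (2 * r * w) ^ 2 := sq_le_sq' (by linarith) h1
  have hDn : D ^ 2 / (2 * n) ≤ 2 / 15 * w ^ 2 := by
    rw [div_le_iff₀ (by positivity)]
    have : 15 * r ^ 2 * w ^ 2 ≤ n * w ^ 2 := by gcongr
    nlinarith
  have hq : √2 ≤ 1.4143 := by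
    rw [Real.sqrt_le_left (by norm_num)]; norm_num
  have hq18 : 4.24 ≤ √18 := by
    apply Real.le_sqrt_of_sq_le; norm_num
  have hrw : 0 ≤ r * w := by positivity
  have hrs : 0 ≤ r * s := by positivity
  have h2' : s' ^ 2 - s ^ 2 ≤ 1.4143 * (r * w) := by nlinarith
  have hw1 : 13 / 15 * w ^ 2 ≤ 2 * s ^ 2 + 1.4143 * (r * w) := by linarith
  -- Solves the quadratic inequality `hw1` for `w`; the coefficients round up `15 √2 / 13` and `√(30
  -- / 13)`.
  have hwb : w ≤ 1.6325 * r + 1.52 * s := by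
    by_contra! hcon
    have a1 : (1.6325 * r + 1.52 * s) * w ≤ w * w := by gcongr
    have a2 : 1.52 * s ≤ w := by linarith
    have a3 : 1.52 * s * (1.52 * s) ≤ 1.52 * s * w := by gcongr
    have a4 : (1.6325 * r + 1.52 * s) * w < w * w :=
      mul_lt_mul_of_pos_right hcon (by nlinarith)
    nlinarith
  have hs'b : s' ≤ s + 1.53 * r := by
    have : r * w ≤ r * (1.6325 * r + 1.52 * s) := by gcongr
    apply abs_le_of_sq_le_sq' _ (by positivity) |>.2
    nlinarith
  have b1 : r * w ≤ r * (1.6325 * r + 1.52 * s) := by gcongr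
  have b2 : 1.5 * s ≤ r * s := by gcongr
  have b3 : 4.24 * (r * s) ≤ √18 * (r * s) := by gcongr
  nlinarith

theorem card_swapPairs_deviation_le {n : ℕ} {r : ℝ} (hr : 0 ≤ r) (hr2 : 2.3 ≤ r ^ 2)
    (hn : 15 * r ^ 2 ≤ n) (p : (Fin n → ℝ) × (Fin n → ℝ))
    (hp1 : ∀ i, p.1 i ∈ Set.Icc (0 : ℝ) 1) (hp2 : ∀ i, p.2 i ∈ Set.Icc (0 : ℝ) 1) :
    (Nat.card {σ : Fin n → Bool //
      √18 * r * √(sumSqDev (swapPairs σ p).1) + 15 * r ^ 2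
        < ∑ i, (swapPairs σ p).2 i - ∑ i, (swapPairs σ p).1 i
          + 1.26 * √(sumSqDev (swapPairs σ p).2) + 10.5} : ℝ)
      ≤ 3 * (2 ^ n * Real.exp (-r ^ 2)) := by
  classical
  have hn0 : n ≠ 0 := by
    rintro rfl
    norm_num at hn
    linarith
  have hnR : (n : ℝ) ≠ 0 := by exact_mod_cast hn0
  -- Exchanges preserve the pooled mean `m` and the pooled squared deviation `W`, so the Hoeffding
  -- thresholds do not depend on `σ`.
  set m : ℝ := (∑ i, p.1 i + ∑ i, p.2 i) / (2 * n) with hm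
  set c : Fin n → ℝ := fun i => p.2 i - p.1 i with hc
  set d : Fin n → ℝ := fun i => (p.2 i - m) ^ 2 - (p.1 i - m) ^ 2 with hd
  set W : ℝ := ∑ i, (p.1 i - m) ^ 2 + ∑ i, (p.2 i - m) ^ 2 with hW
  have hW0 : 0 ≤ W := by positivity
  have hw2 : √W ^ 2 = W := Real.sq_sqrt hW0
  have hmem : m ∈ Set.Icc (0 : ℝ) 1 := by
    have a1 : 0 ≤ ∑ i, p.1 i := Finset.sum_nonneg fun i _ => (hp1 i).1
    have a2 : 0 ≤ ∑ i, p.2 i := Finset.sum_nonneg fun i _ => (hp2 i).1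
    have a3 : ∑ i, p.1 i ≤ n := by
      simpa using Finset.sum_le_sum fun i (_ : i ∈ Finset.univ) => (hp1 i).2
    have a4 : ∑ i, p.2 i ≤ n := by
      simpa using Finset.sum_le_sum fun i (_ : i ∈ Finset.univ) => (hp2 i).2
    refine ⟨by positivity, ?_⟩
    rw [hm, div_le_one (by positivity)]
    linarith
  have hcW : ∑ i, c i ^ 2 ≤ (√2 * √W) ^ 2 := by
    rw [mul_pow, hw2, Real.sq_sqrt (by norm_num), hW, ← Finset.sum_add_distrib, Finset.mul_sum]
    refine Finset.sum_le_sum fun i _ => ?_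
    simp only [hc]
    nlinarith [sq_nonneg ((p.1 i - m) + (p.2 i - m))]
  have hcW' : ∑ i, (-c i) ^ 2 ≤ (√2 * √W) ^ 2 := by simpa using hcW
  -- For `a, b ∈ [0, 1]`, `(b - a) ^ 2 ≤ a ^ 2 + b ^ 2 ≤ a + b`; here `a` and `b` are squared
  -- distances to `m`.
  have hdW : ∑ i, d i ^ 2 ≤ √W ^ 2 := by
    rw [hw2, hW, ← Finset.sum_add_distrib]
    refine Finset.sum_le_sum fun i _ => ?_
    have key : ∀ x ∈ Set.Icc (0 : ℝ) 1, (x - m) ^ 2 ≤ 1 := fun x hx => by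
      rw [sq_le_one_iff_abs_le_one, abs_le]
      constructor <;> linarith [hx.1, hx.2, hmem.1, hmem.2]
    have k1 := key _ (hp1 i)
    have k2 := key _ (hp2 i)
    have k3 := sq_nonneg (p.1 i - m)
    have k4 := sq_nonneg (p.2 i - m)
    simp only [hd]
    nlinarith [mul_nonneg k3 k4, mul_nonneg k3 (sub_nonneg.2 k1), mul_nonneg k4 (sub_nonneg.2 k2)]
  have t1 := card_rademacher_tail_le c hr (by positivity) hcW
  have t2 := card_rademacher_tail_le (fun i => -c i) hr (by positivity) hcW'
  have t3 := card_rademacher_tail_le d hr (by positivity) hdW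
  rw [Nat.card_eq_fintype_card, Fintype.card_subtype] at t1 t2 t3 ⊢
  have h22 : √2 * √2 = 2 := Real.mul_self_sqrt (by norm_num)
  set S₁ := Finset.univ.filter fun σ : Fin n → Bool =>
    √2 * r * (√2 * √W) < ∑ i, boolSign (σ i) * c i with hS₁
  set S₂ := Finset.univ.filter fun σ : Fin n → Bool =>
    √2 * r * (√2 * √W) < ∑ i, boolSign (σ i) * -c i with hS₂
  set S₃ := Finset.univ.filter fun σ : Fin n → Bool =>
    √2 * r * √W < ∑ i, boolSign (σ i) * d i with hS₃
  have hcard : ((S₁ ∪ S₂ ∪ S₃).card : ℝ) ≤ S₁.card + S₂.card + S₃.card := by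
    exact_mod_cast (Finset.card_union_le _ _).trans
      (Nat.add_le_add_right (Finset.card_union_le _ _) _)
  refine le_trans (Nat.cast_le.2 (Finset.card_le_card (t := S₁ ∪ S₂ ∪ S₃) ?_)) ?_
  · intro σ
    simp only [hS₁, hS₂, hS₃, Finset.mem_union, Finset.mem_filter, Finset.mem_univ, true_and]
    intro hσ
    by_contra! hcon
    obtain ⟨⟨g1, g2⟩, g3⟩ := hcon
    refine hσ.not_ge ?_
    set q := swapPairs σ p with hq
    have e1 : ∑ i, boolSign (σ i) * c i = ∑ i, q.2 i - ∑ i, q.1 i := by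
      rw [← Finset.sum_sub_distrib]
      refine Finset.sum_congr rfl fun i _ => ?_
      cases h : σ i <;> simp [hq, swapPairs, h, boolSign, hc]
    have e1' : ∑ i, boolSign (σ i) * -c i = -(∑ i, q.2 i - ∑ i, q.1 i) := by
      rw [← e1, ← Finset.sum_neg_distrib]
      exact Finset.sum_congr rfl fun i _ => by ring
    have e2 : ∑ i, boolSign (σ i) * d i = ∑ i, (q.2 i - m) ^ 2 - ∑ i, (q.1 i - m) ^ 2 := by
      rw [← Finset.sum_sub_distrib]
      refine Finset.sum_congr rfl fun i _ => ?_
      cases h : σ i <;> simp [hq, swapPairs, h, boolSign, hd]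
    have e3 : W = ∑ i, (q.1 i - m) ^ 2 + ∑ i, (q.2 i - m) ^ 2 := by
      rw [hW, ← Finset.sum_add_distrib, ← Finset.sum_add_distrib]
      refine Finset.sum_congr rfl fun i _ => ?_
      cases h : σ i <;> simp [hq, swapPairs, h, add_comm]
    have e4 : m = (∑ i, q.1 i + ∑ i, q.2 i) / (2 * n) := by
      rw [hm, ← Finset.sum_add_distrib, ← Finset.sum_add_distrib]
      congr 1
      refine Finset.sum_congr rfl fun i _ => ?_
      cases h : σ i <;> simp [hq, swapPairs, h, add_comm]
    rw [e1] at g1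
    rw [e1'] at g2
    rw [e2] at g3
    rw [sum_sq_sub_eq hn0, sum_sq_sub_eq hn0] at e3 g3
    set D := ∑ i, q.2 i - ∑ i, q.1 i with hD
    -- The two sample means lie at `m ∓ D / (2 n)`.
    have m1 : (n : ℝ) * (sampleMean q.1 - m) ^ 2 = D ^ 2 / (4 * n) := by
      rw [e4, sampleMean, hD]; field_simp; ring
    have m2 : (n : ℝ) * (sampleMean q.2 - m) ^ 2 = D ^ 2 / (4 * n) := by
      rw [e4, sampleMean, hD]; field_simp; ring
    rw [m1, m2] at e3 g3
    refine swap_deviation_bound hr hr2 hn (Real.sqrt_nonneg _) (Real.sqrt_nonneg W)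
      ?_ ?_ ?_ ?_
    · calc D ≤ _ := g1
        _ = (√2 * √2) * r * √W := by ring
        _ = _ := by rw [h22]
    · calc -D ≤ _ := g2
        _ = (√2 * √2) * r * √W := by ring
        _ = _ := by rw [h22]
    · rw [Real.sq_sqrt (sumSqDev_nonneg _), Real.sq_sqrt (sumSqDev_nonneg _)]
      linarith
    · rw [Real.sq_sqrt (sumSqDev_nonneg _), Real.sq_sqrt (sumSqDev_nonneg _), hw2, e3]
      field_simp
      ring
  · linarith

/-! ### A lower deviation bound of constant probability -/

/-- Markov's inequality; strictness keeps it true for `m = 0`, so zero variance is covered. -/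
theorem measureReal_mul_lt_le {Y : Type*} [MeasurableSpace Y] {μ : Measure Y}
    [IsProbabilityMeasure μ] {g : Y → ℝ} (hg : Integrable g μ) (h0 : ∀ y, 0 ≤ g y) {m k : ℝ}
    (hm : ∫ y, g y ∂μ ≤ m) (hk : 0 < k) : μ.real {y | k * m < g y} ≤ 1 / k := by
  have hI : 0 ≤ ∫ y, g y ∂μ := integral_nonneg h0
  rcases (hI.trans hm).eq_or_lt with h | h
  · have h1 : ∫ y, g y ∂μ = 0 := le_antisymm (h ▸ hm) hI
    have h2 := (integral_eq_zero_iff_of_nonneg h0 hg).1 h1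
    have h3 : μ {y | k * m < g y} = 0 := by
      refine measure_mono_null ?_ (ae_iff.1 h2)
      intro y hy
      simp only [Set.mem_ofPred_eq, ← h, mul_zero] at hy
      exact hy.ne'
    rw [measureReal_def, h3]
    simpa using hk.le
  · have h1 := mul_meas_ge_le_integral_of_nonneg (ae_of_all _ h0) hg (k * m)
    have h2 : μ.real {y | k * m < g y} ≤ μ.real {y | k * m ≤ g y} :=
      measureReal_mono fun y (hy : k * m < g y) => hy.le
    have h3 : k * m * μ.real {y | k * m ≤ g y} ≤ m := h1.trans hm
    rw [le_div_iff₀ hk]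
    have h4 : m * (μ.real {y | k * m < g y} * k) ≤ m * 1 := by
      nlinarith [mul_le_mul_of_nonneg_left h2 (mul_nonneg hk.le h.le)]
    exact le_of_mul_le_mul_left h4 h

section Samples

variable {Z : Type*} [Finite Z] [MeasurableSpace Z] [MeasurableSingletonClass Z]

theorem integral_sq_sum_sub {n : ℕ} (ρ : Measure Z) [IsProbabilityMeasure ρ] (g : Z → ℝ) :
    ∫ x, (∑ i, g (x i) - n * ∫ z, g z ∂ρ) ^ 2 ∂(Measure.pi fun _ : Fin n => ρ)
      = n * Var[g; ρ] := by
  have h := variance_sum_pi (μ := fun _ : Fin n => ρ) (X := fun _ => g)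
    fun _ => .of_discrete
  rw [variance_eq_integral (Measurable.of_discrete.aemeasurable)] at h
  have hmean : ∫ x, (∑ i : Fin n, fun ω : Fin n → Z => g (ω i)) x ∂(Measure.pi fun _ => ρ)
      = n * ∫ z, g z ∂ρ := by
    simp only [Finset.sum_apply]
    rw [integral_finsetSum _ fun i _ => Integrable.of_finite]
    have : ∀ i : Fin n, ∫ x : Fin n → Z, g (x i) ∂(Measure.pi fun _ => ρ) = ∫ z, g z ∂ρ := by
      intro i
      have hi := measurePreserving_eval (fun _ : Fin n => ρ) i
      conv_rhs => rw [← hi.map_eq]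
      rw [integral_map (Measurable.of_discrete.aemeasurable) .of_discrete]
    simp [this]
  rw [hmean] at h
  simpa using h

/-- The second hypothesis on `S` bounds the true deviation `v` by the empirical `s` through a
quadratic inequality; then `d ≤ √1.5 * v`. -/
theorem mean_deviation_bound {n s v d S : ℝ} (hn : 36 ≤ n) (hs : 0 ≤ s) (hv : 0 ≤ v)
    (hd : d ^ 2 ≤ 1.5 * v ^ 2) (hS : (S - v ^ 2) ^ 2 ≤ 30 * v ^ 2)
    (hs2 : S = s ^ 2 + d ^ 2 / n) : d ≤ 1.26 * s + 7.01 := by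
  have h1 : d ≤ 1.225 * v := by
    apply abs_le_of_sq_le_sq' _ (by positivity) |>.2
    nlinarith
  have h2 : v ^ 2 - S ≤ 5.48 * v := by
    apply abs_le_of_sq_le_sq' _ (by positivity) |>.2
    nlinarith
  have h3 : d ^ 2 / n ≤ v ^ 2 / 24 := by
    rw [div_le_iff₀ (by linarith)]
    nlinarith [mul_le_mul_of_nonneg_left hn (sq_nonneg v)]
  have h4 : 23 / 24 * v ^ 2 ≤ s ^ 2 + 5.48 * v := by linarith
  have h5 : v ≤ 1.022 * s + 5.72 := by
    by_contra! hcon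
    have a1 : (1.022 * s + 5.72) * v ≤ v * v := by gcongr
    have a2 : 1.022 * s ≤ v := by linarith
    have a3 : 1.022 * s * (1.022 * s) ≤ 1.022 * s * v := by gcongr
    have a4 : 0 < v := by linarith
    nlinarith
  linarith

/-- With probability at least `3 / 10`, the mean of a function with values in `[0, 1]` does not
exceed its empirical mean by more than a multiple of the empirical standard deviation plus a
remainder of smaller order. -/
theorem integral_le_sum_add_sqrt_sumSqDev {n : ℕ} (hn : 36 ≤ n) (ρ : Measure Z)
    [IsProbabilityMeasure ρ] (f : Z → ℝ) (hf : ∀ z, f z ∈ Set.Icc (0 : ℝ) 1) :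
    3 / 10 ≤ (Measure.pi fun _ : Fin n => ρ).real {x | n * ∫ z, f z ∂ρ
      ≤ ∑ i, f (x i) + 1.26 * √(sumSqDev fun i => f (x i)) + 7.01} := by
  set P := Measure.pi fun _ : Fin n => ρ with hP
  set p := ∫ z, f z ∂ρ with hp
  have hp0 : 0 ≤ p := integral_nonneg fun z => (hf z).1
  have hp1 : p ≤ 1 := by
    calc p ≤ ∫ _z, (1 : ℝ) ∂ρ :=
          integral_mono Integrable.of_finite Integrable.of_finite fun z => (hf z).2
      _ = 1 := by simp
  set σ := Var[f; ρ] with hσ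
  have hσ0 : 0 ≤ σ := variance_nonneg _ _
  have hσe : ∫ z, (f z - p) ^ 2 ∂ρ = σ := by
    rw [hσ, variance_eq_integral (Measurable.of_discrete.aemeasurable)]
  -- As `(f - p) ^ 2` lies in `[0, 1]`, its second moment is at most its mean `σ`.
  have hvar : Var[fun z => (f z - p) ^ 2; ρ] ≤ σ := by
    refine (variance_le_expectation_sq Measurable.of_discrete.aestronglyMeasurable).trans ?_
    rw [← hσe]
    refine integral_mono Integrable.of_finite Integrable.of_finite fun z => ?_
    have h1 : (f z - p) ^ 2 ≤ 1 := by
      rw [sq_le_one_iff_abs_le_one, abs_le]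
      constructor <;> linarith [(hf z).1, (hf z).2]
    simp only [Pi.pow_apply]
    nlinarith [sq_nonneg (f z - p)]
  -- Two Chebyshev bounds, failing with probability at most `2 / 3` and `1 / 30`; this leaves `3 /
  -- 10`.
  have hA := measureReal_mul_lt_le (μ := P) (k := 3 / 2) Integrable.of_finite
    (fun x => sq_nonneg _) (integral_sq_sum_sub (n := n) ρ f).le (by norm_num)
  have hB := measureReal_mul_lt_le (μ := P) (k := 30) (m := n * σ) Integrable.of_finite
    (fun x => sq_nonneg _) ((integral_sq_sum_sub (n := n) ρ fun z => (f z - p) ^ 2).le.trans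
      (mul_le_mul_of_nonneg_left hvar (Nat.cast_nonneg n))) (by norm_num)
  rw [hσe] at hB
  set A := {x : Fin n → Z | 3 / 2 * (n * σ) < (∑ i, f (x i) - n * p) ^ 2}
  set B := {x : Fin n → Z | 30 * (n * σ) < (∑ i, (f (x i) - p) ^ 2 - n * σ) ^ 2}
  set G := {x : Fin n → Z | n * p ≤ ∑ i, f (x i) + 1.26 * √(sumSqDev fun i => f (x i)) + 7.01}
  have hcover : (Set.univ : Set (Fin n → Z)) ⊆ (A ∪ B) ∪ G := by
    intro x _
    by_contra hx
    simp only [Set.mem_union, not_or] at hx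
    obtain ⟨⟨hxA, hxB⟩, hxG⟩ := hx
    refine hxG ?_
    simp only [A, B, Set.mem_ofPred_eq, not_lt] at hxA hxB
    have hn0 : (n : ℝ) ≠ 0 := by positivity
    have hv : √(n * σ) ^ 2 = n * σ := Real.sq_sqrt (by positivity)
    have key := mean_deviation_bound (n := n) (s := √(sumSqDev fun i => f (x i))) (v := √(n * σ))
      (d := n * p - ∑ i, f (x i)) (S := ∑ i, (f (x i) - p) ^ 2) (by exact_mod_cast hn)
      (Real.sqrt_nonneg _) (Real.sqrt_nonneg _) (by rw [hv]; nlinarith) (by rw [hv]; exact hxB)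
      (by
        rw [Real.sq_sqrt (sumSqDev_nonneg _), sum_sq_sub_eq (by positivity)]
        simp only [sampleMean]
        field_simp
        ring)
    simp only [G, Set.mem_ofPred_eq]
    linarith
  have h1 : (1 : ℝ) ≤ P.real ((A ∪ B) ∪ G) := by
    rw [← probReal_univ (μ := P)]
    exact measureReal_mono hcover
  have h2 := measureReal_union_le (μ := P) (A ∪ B) G
  have h3 := measureReal_union_le (μ := P) A B
  norm_num at hA hB
  linarith

/-! ### Symmetrization -/

/-- By invariance `κ E` is the mean over `σ` of `κ (s σ ⁻¹' E)`, that is, the integral of the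
fraction of `σ` with `s σ y ∈ E`. -/
theorem measureReal_le_of_card_le {Y S : Type*} [Finite Y] [MeasurableSpace Y]
    [MeasurableSingletonClass Y] [Fintype S] [Nonempty S] {κ : Measure Y} [IsProbabilityMeasure κ]
    {s : S → Y → Y} (hs : ∀ σ, MeasurePreserving (s σ) κ κ) {E : Set Y} {b : ℝ}
    (h : ∀ y, (Nat.card {σ // s σ y ∈ E} : ℝ) ≤ Fintype.card S * b) : κ.real E ≤ b := by
  classical
  have hE : MeasurableSet E := .of_discrete
  have h1 : (Fintype.card S : ℝ) * κ.real E = ∫ y, (Nat.card {σ // s σ y ∈ E} : ℝ) ∂κ := by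
    have h2 : ∀ y, (Nat.card {σ // s σ y ∈ E} : ℝ)
        = ∑ σ, (s σ ⁻¹' E).indicator (1 : Y → ℝ) y := by
      intro y
      rw [Nat.card_eq_fintype_card, Fintype.card_subtype]
      simp [Set.indicator_apply]
    simp_rw [h2]
    rw [integral_finsetSum _ fun i _ => Integrable.of_finite]
    have h3 : ∀ σ, ∫ y, (s σ ⁻¹' E).indicator (1 : Y → ℝ) y ∂κ = κ.real E := by
      intro σ
      rw [integral_indicator_one .of_discrete]
      exact (hs σ).measureReal_preimage hE.nullMeasurableSet
    simp [h3]
  have h4 : (Fintype.card S : ℝ) * κ.real E ≤ Fintype.card S * b := by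
    rw [h1]
    calc ∫ y, (Nat.card {σ // s σ y ∈ E} : ℝ) ∂κ ≤ ∫ _y, (Fintype.card S * b : ℝ) ∂κ :=
          integral_mono Integrable.of_finite Integrable.of_finite h
      _ = _ := by simp
  exact le_of_mul_le_mul_left h4 (by exact_mod_cast Fintype.card_pos)

theorem measurePreserving_swapPairs {n : ℕ} (ρ : Measure Z) [IsProbabilityMeasure ρ]
    (σ : Fin n → Bool) :
    MeasurePreserving (swapPairs σ)
      ((Measure.pi fun _ : Fin n => ρ).prod (Measure.pi fun _ : Fin n => ρ))
      ((Measure.pi fun _ : Fin n => ρ).prod (Measure.pi fun _ : Fin n => ρ)) := by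
  refine ⟨.of_discrete, Measure.ext_iff_singleton.2 fun q => ?_⟩
  have hinv : ∀ p : (Fin n → Z) × (Fin n → Z), swapPairs σ (swapPairs σ p) = p := by
    intro p
    ext i <;> cases h : σ i <;> simp [swapPairs, h]
  have hpre : swapPairs σ ⁻¹' {q} = {swapPairs σ q} := by
    ext p
    simp only [Set.mem_preimage, Set.mem_singleton_iff]
    exact ⟨fun h => by rw [← h, hinv], fun h => by rw [h, hinv]⟩
  rw [Measure.map_apply .of_discrete .of_discrete, hpre]
  have hs : ∀ p : (Fin n → Z) × (Fin n → Z), ({p} : Set _) = {p.1} ×ˢ {p.2} := fun p => by simp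
  rw [hs, hs q, Measure.prod_prod, Measure.prod_prod]
  simp only [Measure.pi_singleton]
  rw [← Finset.prod_mul_distrib, ← Finset.prod_mul_distrib]
  refine Finset.prod_congr rfl fun i _ => ?_
  cases h : σ i <;> simp [swapPairs, h, mul_comm]

theorem mul_measureReal_le_prod {Y : Type*} [Finite Y] [MeasurableSpace Y]
    [MeasurableSingletonClass Y] {μ : Measure Y} [IsProbabilityMeasure μ] {B : Set Y}
    {E : Set (Y × Y)} {c : ℝ} (hc : 0 ≤ c) (hE : ∀ x ∈ B, c ≤ μ.real {y | (x, y) ∈ E}) :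
    c * μ.real B ≤ (μ.prod μ).real E := by
  have h : ENNReal.ofReal c * μ B ≤ (μ.prod μ) E := by
    rw [Measure.prod_apply .of_discrete]
    calc ENNReal.ofReal c * μ B = ∫⁻ _x in B, ENNReal.ofReal c ∂μ := by simp
      _ ≤ ∫⁻ x in B, μ (Prod.mk x ⁻¹' E) ∂μ := by
          refine setLIntegral_mono .of_discrete fun x hx => ?_
          exact ENNReal.ofReal_le_of_le_toReal (hE x hx)
      _ ≤ ∫⁻ x, μ (Prod.mk x ⁻¹' E) ∂μ := setLIntegral_le_lintegral _ _
  have h' := ENNReal.toReal_mono (measure_ne_top _ _) h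
  rwa [ENNReal.toReal_mul, ENNReal.toReal_ofReal hc] at h'

end Samples

/-! ### The uniform empirical Bernstein bound -/

/-- The pair is read as one `2 n`-tuple. Exchanges only permute its entries, so the same cover
serves every `σ`. Centres taken from `G` keep their values in `[0, 1]`. -/
theorem exists_finset_cover {Z : Type*} [Finite Z] {ε : ℝ≥0} (hε : 0 < ε) {G : Set (Z → ℝ)}
    (hG : ∀ g ∈ G, ∀ z, g z ∈ Set.Icc (0 : ℝ) 1) {n : ℕ} (p : (Fin n → Z) × (Fin n → Z)) :
    ∃ C : Finset (Z → ℝ), ↑C ⊆ G ∧ C.card ≤ (uniformCoveringNumber ε G (2 * n)).toNat ∧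
      ∀ g ∈ G, ∃ h ∈ C, ∀ i, |g (p.1 i) - h (p.1 i)| ≤ ε ∧ |g (p.2 i) - h (p.2 i)| ≤ ε := by
  classical
  let e : Fin n ⊕ Fin n ≃ Fin (2 * n) := finSumFinEquiv.trans (finCongr (two_mul n).symm)
  let φ : (Z → ℝ) → Fin (2 * n) → ℝ := fun g i => g (Sum.elim p.1 p.2 (e.symm i))
  have htop := uniformCoveringNumber_ne_top hε hG (2 * n)
  have hle : Metric.coveringNumber ε (φ '' G) ≤ uniformCoveringNumber ε G (2 * n) :=
    le_iSup (fun z : Fin (2 * n) → Z =>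
      Metric.coveringNumber ε ((fun g : Z → ℝ => fun i => g (z i)) '' G))
      fun i => Sum.elim p.1 p.2 (e.symm i)
  obtain ⟨C, hCG, hCfin, hC, hcard⟩ :=
    Metric.exists_set_encard_eq_coveringNumber (ne_top_of_le_ne_top htop hle)
  have hCG' : ∀ c ∈ C, ∃ g, g ∈ G ∧ φ g = c := hCG
  choose! s hsG hs using hCG'
  refine ⟨hCfin.toFinset.image s, ?_, ?_, fun g hg => ?_⟩
  · intro g hg
    obtain ⟨c, hc, rfl⟩ := Finset.mem_image.1 hg
    exact hsG _ (hCfin.mem_toFinset.1 hc)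
  · refine Finset.card_image_le.trans ?_
    have h1 : ((hCfin.toFinset.card : ℕ) : ℕ∞) ≤ uniformCoveringNumber ε G (2 * n) := by
      rw [← hCfin.encard_eq_coe_toFinset_card, hcard]
      exact hle
    simpa using ENat.toNat_le_toNat h1 htop
  · obtain ⟨c, hc, hgc⟩ := hC (Set.mem_image_of_mem φ hg)
    refine ⟨s c, Finset.mem_image_of_mem _ (hCfin.mem_toFinset.2 hc), fun i => ?_⟩
    have hd : dist (φ g) (φ (s c)) ≤ ε := by
      rw [hs _ hc]
      have h2 : edist (φ g) c ≤ ε := hgc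
      rw [edist_nndist] at h2
      exact_mod_cast h2
    have hcoord : ∀ j, |φ g j - φ (s c) j| ≤ ε := fun j =>
      (Real.dist_eq _ _ ▸ dist_le_pi_dist (φ g) (φ (s c)) j).trans hd
    exact ⟨by simpa [φ] using hcoord (e (Sum.inl i)), by simpa [φ] using hcoord (e (Sum.inr i))⟩

theorem swapPairs_comp {n : ℕ} {Z Y : Type*} (h : Z → Y) (σ : Fin n → Bool)
    (p : (Fin n → Z) × (Fin n → Z)) :
    swapPairs σ (fun i => h (p.1 i), fun i => h (p.2 i))
      = (fun i => h ((swapPairs σ p).1 i), fun i => h ((swapPairs σ p).2 i)) := by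
  ext i <;> cases hi : σ i <;> simp [swapPairs, hi]

/-- Passing to a cover centre costs at most `1` for each sum, `1.26 / 6` for the second deviation
and `√(18 / 15) < 1.1` for the first: less than `10.5 - 7.01`. -/
theorem deviation_le_of_close {n : ℕ} {r : ℝ} (hr : 0 ≤ r) (hn : 36 ≤ n) (hrn : 15 * r ^ 2 ≤ n)
    {v v' w w' : Fin n → ℝ} (hv : ∀ i, |v i - w i| ≤ 1 / n) (hv' : ∀ i, |v' i - w' i| ≤ 1 / n)
    (h : √18 * r * √(sumSqDev v) + 15 * r ^ 2
      < ∑ i, v' i - ∑ i, v i + 1.26 * √(sumSqDev v') + 7.01) :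
    √18 * r * √(sumSqDev w) + 15 * r ^ 2
      < ∑ i, w' i - ∑ i, w i + 1.26 * √(sumSqDev w') + 10.5 := by
  have hn0 : (0 : ℝ) < n := by positivity
  have hnR : (36 : ℝ) ≤ n := by exact_mod_cast hn
  have hη2 : (√n * (1 / n)) ^ 2 = 1 / (n : ℝ) := by
    rw [mul_pow, Real.sq_sqrt hn0.le]
    field_simp
  have hη0 : 0 ≤ √n * (1 / (n : ℝ)) := by positivity
  have a1 := sqrt_sumSqDev_le_add (by positivity) hv'
  have a2 := sqrt_sumSqDev_le_add (δ := 1 / (n : ℝ)) (by positivity)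
    fun i => (abs_sub_comm (w i) (v i)).trans_le (hv i)
  set η := √n * (1 / (n : ℝ))
  have hsum : ∀ {x y : Fin n → ℝ}, (∀ i, x i - y i ≤ 1 / n) → ∑ i, x i - ∑ i, y i ≤ 1 := by
    intro x y hxy
    rw [← Finset.sum_sub_distrib]
    calc ∑ i, (x i - y i) ≤ ∑ _i : Fin n, (1 / n : ℝ) := Finset.sum_le_sum fun i _ => hxy i
      _ = 1 := by simp [hn0.ne']
  have b1 := hsum fun i => (abs_le.1 (hv' i)).2
  have b2 := hsum (x := w) (y := v) fun i => by linarith [(abs_le.1 (hv i)).1]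
  have hη : η ≤ 1 / 6 := by
    apply abs_le_of_sq_le_sq' _ (by norm_num) |>.2
    rw [hη2, div_pow]
    exact (one_div_le_one_div_of_le (by norm_num) hnR).trans (by norm_num)
  have hη' : √18 * r * η ≤ 1.1 := by
    apply abs_le_of_sq_le_sq' _ (by norm_num) |>.2
    rw [mul_pow, mul_pow, hη2, Real.sq_sqrt (by norm_num), mul_one_div, div_le_iff₀ hn0]
    nlinarith
  have c1 := mul_le_mul_of_nonneg_left a2 (show 0 ≤ √18 * r by positivity)
  rw [mul_add] at c1
  linarith

theorem log_ten_ge : (2.3 : ℝ) ≤ Real.log 10 := by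
  have h1 : Real.exp 23 ≤ 10 ^ 10 := by
    have h2 : Real.exp 23 = Real.exp 1 ^ 23 := by rw [← Real.exp_nat_mul]; norm_num
    rw [h2]
    calc Real.exp 1 ^ 23 ≤ 2.7182818286 ^ 23 :=
          pow_le_pow_left₀ (Real.exp_pos _).le Real.exp_one_lt_d9.le _
      _ ≤ 10 ^ 10 := by norm_num
  have h3 := (Real.le_log_iff_exp_le (by positivity)).2 h1
  rw [Real.log_pow] at h3
  push_cast at h3
  linarith

theorem one_le_uniformCoveringNumber_toNat {Y : Type*} [Finite Y] [Nonempty Y] {ε : ℝ≥0}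
    (hε : 0 < ε) {G : Set (Y → ℝ)} (hG : ∀ g ∈ G, ∀ z, g z ∈ Set.Icc (0 : ℝ) 1)
    (hne : G.Nonempty) (m : ℕ) : 1 ≤ (uniformCoveringNumber ε G m).toNat := by
  obtain ⟨y⟩ := ‹Nonempty Y›
  have h1 : 1 ≤ Metric.coveringNumber ε
      ((fun g : Y → ℝ => fun _ : Fin m => g y) '' G) :=
    Order.one_le_iff_pos.2 (Metric.coveringNumber_pos_iff.2 (hne.image _))
  have h2 : 1 ≤ uniformCoveringNumber ε G m :=
    h1.trans (le_iSup (fun z : Fin m → Y =>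
      Metric.coveringNumber ε ((fun g : Y → ℝ => fun i => g (z i)) '' G)) fun _ => y)
  simpa using ENat.toNat_le_toNat h2 (uniformCoveringNumber_ne_top hε hG m)

theorem card_swapPairs_exists_deviation_le {Z : Type*} [Finite Z] {G : Set (Z → ℝ)}
    (hG : ∀ g ∈ G, ∀ z, g z ∈ Set.Icc (0 : ℝ) 1) {n : ℕ} (hn : 36 ≤ n) {r : ℝ} (hr : 0 ≤ r)
    (hr2 : 2.3 ≤ r ^ 2) (hrn : 15 * r ^ 2 ≤ n) (p : (Fin n → Z) × (Fin n → Z)) :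
    (Nat.card {σ : Fin n → Bool // ∃ g ∈ G,
      √18 * r * √(sumSqDev fun i => g ((swapPairs σ p).1 i)) + 15 * r ^ 2
        < ∑ i, g ((swapPairs σ p).2 i) - ∑ i, g ((swapPairs σ p).1 i)
          + 1.26 * √(sumSqDev fun i => g ((swapPairs σ p).2 i)) + 7.01} : ℝ)
      ≤ 2 ^ n * ((uniformCoveringNumber (1 / (n : ℝ≥0)) G (2 * n)).toNat
          * (3 * Real.exp (-r ^ 2))) := by
  classical
  have hn0 : n ≠ 0 := by omega
  obtain ⟨C, hCG, hCcard, hC⟩ := exists_finset_cover (ε := 1 / (n : ℝ≥0)) (by positivity) hG p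
  rw [Nat.card_eq_fintype_card, Fintype.card_subtype]
  let S : (Z → ℝ) → Finset (Fin n → Bool) := fun h => Finset.univ.filter fun σ =>
    √18 * r * √(sumSqDev fun i => h ((swapPairs σ p).1 i)) + 15 * r ^ 2
        < ∑ i, h ((swapPairs σ p).2 i) - ∑ i, h ((swapPairs σ p).1 i)
          + 1.26 * √(sumSqDev fun i => h ((swapPairs σ p).2 i)) + 10.5
  have hS : ∀ h ∈ C, ((S h).card : ℝ) ≤ 3 * (2 ^ n * Real.exp (-r ^ 2)) := by
    intro h hh
    have := card_swapPairs_deviation_le hr hr2 hrn (fun i => h (p.1 i), fun i => h (p.2 i))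
      (fun i => hG h (hCG hh) _) fun i => hG h (hCG hh) _
    simp only [swapPairs_comp] at this
    rwa [Nat.card_eq_fintype_card, Fintype.card_subtype] at this
  have hsub : (Finset.univ.filter fun σ : Fin n → Bool => ∃ g ∈ G,
      √18 * r * √(sumSqDev fun i => g ((swapPairs σ p).1 i)) + 15 * r ^ 2
        < ∑ i, g ((swapPairs σ p).2 i) - ∑ i, g ((swapPairs σ p).1 i)
          + 1.26 * √(sumSqDev fun i => g ((swapPairs σ p).2 i)) + 7.01) ⊆ C.biUnion S := by
    intro σ hσ
    obtain ⟨g, hg, hdev⟩ := (Finset.mem_filter.1 hσ).2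
    obtain ⟨h, hh, hclose⟩ := hC g hg
    push_cast at hclose
    refine Finset.mem_biUnion.2 ⟨h, hh, Finset.mem_filter.2 ⟨Finset.mem_univ _, ?_⟩⟩
    refine deviation_le_of_close hr hn hrn (fun i => ?_) (fun i => ?_) hdev
    · cases hi : σ i
      · simpa [swapPairs, hi] using (hclose i).1
      · simpa [swapPairs, hi] using (hclose i).2
    · cases hi : σ i
      · simpa [swapPairs, hi] using (hclose i).2
      · simpa [swapPairs, hi] using (hclose i).1
  calc ((Finset.card _ : ℕ) : ℝ) ≤ ∑ h ∈ C, ((S h).card : ℝ) := by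
        exact_mod_cast (Finset.card_le_card hsub).trans Finset.card_biUnion_le
    _ ≤ ∑ _h ∈ C, 3 * (2 ^ n * Real.exp (-r ^ 2)) := Finset.sum_le_sum hS
    _ = C.card * (3 * (2 ^ n * Real.exp (-r ^ 2))) := by simp
    _ ≤ (uniformCoveringNumber (1 / (n : ℝ≥0)) G (2 * n)).toNat
          * (3 * (2 ^ n * Real.exp (-r ^ 2))) := by
        gcongr
    _ = _ := by ring

theorem sqrt_sumSqDev_le_mul_sqrt_sampleVariance {n : ℕ} (hn : 2 ≤ n) (v : Fin n → ℝ) :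
    √(sumSqDev v) ≤ n * √(sampleVariance v / n) := by
  have hnR : (2 : ℝ) ≤ n := by exact_mod_cast hn
  apply Real.sqrt_le_iff.2
  have hV : sampleVariance v / n = sumSqDev v / ((n - 1) * n) := by
    rw [sampleVariance, sumSqDev, div_div]
  have hs := sumSqDev_nonneg v
  have h1 : (0 : ℝ) < n - 1 := by linarith
  refine ⟨by positivity, ?_⟩
  rw [mul_pow, Real.sq_sqrt (by rw [hV]; positivity), hV]
  have h2 : (n : ℝ) ^ 2 * (sumSqDev v / ((n - 1) * n)) = n * sumSqDev v / (n - 1) := by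
    field_simp
  rw [h2, le_div_iff₀ h1]
  nlinarith

/-- The uniform empirical Bernstein inequality. -/
theorem measureReal_exists_gt_empirical_bernstein_le {Z : Type*} [Finite Z] [MeasurableSpace Z]
    [MeasurableSingletonClass Z] (ρ : Measure Z) [IsProbabilityMeasure ρ]
    {G : Set (Z → ℝ)} (hG : ∀ g ∈ G, ∀ z, g z ∈ Set.Icc (0 : ℝ) 1) (hne : G.Nonempty)
    {γ : ℝ} (hγ : 0 < γ) (hγ' : γ < 1) {n : ℕ} (hn : 2 ≤ n) :
    (Measure.pi fun _ : Fin n => ρ).real {x | ∃ g ∈ G,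
      sampleMean (fun i => g (x i))
        + confidenceCoeff G n γ * √(sampleVariance (fun i => g (x i)) / n)
        + 15 * confidenceCoeff G n γ ^ 2 / (18 * (n - 1)) < ∫ z, g z ∂ρ} ≤ γ := by
  have hnR : (2 : ℝ) ≤ n := by exact_mod_cast hn
  have : Nonempty Z := nonempty_of_isProbabilityMeasure ρ
  have hN := one_le_uniformCoveringNumber_toNat (ε := 1 / (n : ℝ≥0)) (by positivity) hG hne (2 * n)
  set N : ℝ := ((uniformCoveringNumber (1 / (n : ℝ≥0)) G (2 * n)).toNat : ℝ) with hNdef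
  have hN1 : (1 : ℝ) ≤ N := by rw [hNdef]; exact_mod_cast hN
  set l := Real.log (10 * N / γ) with hl
  have hl23 : 2.3 ≤ l := by
    refine log_ten_ge.trans (Real.log_le_log (by norm_num) ?_)
    rw [le_div_iff₀ hγ]
    nlinarith
  have hr2 : √l ^ 2 = l := Real.sq_sqrt (by linarith)
  have hconf : confidenceCoeff G n γ = √18 * √l := by
    rw [confidenceCoeff, Real.sqrt_mul (by norm_num)]
  have hconf2 : confidenceCoeff G n γ ^ 2 = 18 * l := by
    rw [hconf, mul_pow, hr2, Real.sq_sqrt (by norm_num)]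
  have hbonus : 15 * confidenceCoeff G n γ ^ 2 / (18 * (n - 1)) = 15 * l / (n - 1) := by
    rw [hconf2]
    have : (n : ℝ) - 1 ≠ 0 := by linarith
    field_simp
  rw [hbonus, hconf]
  set B := {x : Fin n → Z | ∃ g ∈ G, sampleMean (fun i => g (x i))
        + √18 * √l * √(sampleVariance (fun i => g (x i)) / n) + 15 * l / (n - 1) < ∫ z, g z ∂ρ}
  -- In this case the remainder is at least `1`, so no violation is possible. Otherwise `n > 1 + 15
  -- * 2.3`, which gives `36 ≤ n`.
  by_cases hbig : (n : ℝ) - 1 ≤ 15 * l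
  · have hB : B = ∅ := by
      refine Set.eq_empty_iff_forall_notMem.2 fun x hx => ?_
      obtain ⟨g, hg, hlt⟩ := hx
      have h1 : 1 ≤ 15 * l / (n - 1) := by
        rw [le_div_iff₀ (by linarith)]
        linarith
      have h2 : ∫ z, g z ∂ρ ≤ 1 := by
        calc ∫ z, g z ∂ρ ≤ ∫ _z, (1 : ℝ) ∂ρ :=
              integral_mono Integrable.of_finite Integrable.of_finite fun z => (hG g hg z).2
          _ = 1 := by simp
      have h3 : 0 ≤ sampleMean (fun i => g (x i)) :=
        div_nonneg (Finset.sum_nonneg fun i _ => (hG g hg _).1) (by positivity)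
      have h4 : 0 ≤ √18 * √l * √(sampleVariance (fun i => g (x i)) / n) := by positivity
      linarith
    rw [hB]
    simpa using hγ.le
  push Not at hbig
  have hn36 : 36 ≤ n := by
    have h1 : (35 : ℝ) < n := by linarith
    have h2 : 35 < n := by exact_mod_cast h1
    omega
  set E := {p : (Fin n → Z) × (Fin n → Z) | ∃ g ∈ G,
      √18 * √l * √(sumSqDev fun i => g (p.1 i)) + 15 * √l ^ 2
        < ∑ i, g (p.2 i) - ∑ i, g (p.1 i) + 1.26 * √(sumSqDev fun i => g (p.2 i)) + 7.01}
  have hBE : ∀ x ∈ B, 3 / 10 ≤ (Measure.pi fun _ : Fin n => ρ).real {y | (x, y) ∈ E} := by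
    rintro x ⟨g, hg, hlt⟩
    refine (integral_le_sum_add_sqrt_sumSqDev hn36 ρ g (hG g hg)).trans
      (measureReal_mono fun y hy => ⟨g, hg, ?_⟩)
    have hy' : n * ∫ z, g z ∂ρ
      ≤ ∑ i, g (y i) + 1.26 * √(sumSqDev fun i => g (y i)) + 7.01 := hy
    have h1 := mul_lt_mul_of_pos_left hlt (show (0 : ℝ) < n by linarith)
    have h2 : (n : ℝ) * sampleMean (fun i => g (x i)) = ∑ i, g (x i) := by
      rw [sampleMean]; field_simp
    have h3 : 15 * l ≤ n * (15 * l / (n - 1)) := by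
      rw [mul_div_assoc', le_div_iff₀ (by linarith)]
      nlinarith
    have h4 := mul_le_mul_of_nonneg_left
      (sqrt_sumSqDev_le_mul_sqrt_sampleVariance hn fun i => g (x i))
      (show 0 ≤ √18 * √l by positivity)
    rw [hr2]
    simp only
    nlinarith
  have hsym := mul_measureReal_le_prod (by norm_num) hBE
  have hswap := measureReal_le_of_card_le (S := Fin n → Bool) (b := N * (3 * Real.exp (-√l ^ 2)))
    (measurePreserving_swapPairs ρ) (E := E) fun p => by
      have := card_swapPairs_exists_deviation_le hG hn36 (Real.sqrt_nonneg l)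
        (by rw [hr2]; exact hl23) (by rw [hr2]; linarith) p
      have hc : (Fintype.card (Fin n → Bool) : ℝ) = 2 ^ n := by simp
      rw [hc]
      exact this
  have hexp : N * (3 * Real.exp (-√l ^ 2)) = 3 / 10 * γ := by
    rw [hr2, Real.exp_neg, hl, Real.exp_log (by positivity)]
    field_simp
  rw [hexp] at hswap
  linarith

/-! ### Importance weighted utilities -/

theorem observationLaw_apply {X F A : Type*} [Fintype X] [Fintype F] [Fintype A] (μ : PMF X)
    (ν : PMF F) (π₀ : Policy X F A) (x : X) (f : F) (a : A) :
    observationLaw μ ν π₀ (x, f, a) = μ x * (ν f * π₀ x f a) := by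
  classical
  simp only [observationLaw, PMF.bind_apply, PMF.map_apply, tsum_fintype, Prod.mk.injEq]
  rw [Finset.sum_eq_single x, Finset.sum_eq_single f]
  · simp
  · intro f' _ hf'
    simp [hf'.symm]
  · simp
  · intro x' _ hx'
    simp [hx'.symm]
  · simp

theorem integral_weightedUtility {X F A : Type*} [Fintype X] [Fintype F] [Fintype A]
    [MeasurableSpace X] [MeasurableSingletonClass X] [MeasurableSpace F]
    [MeasurableSingletonClass F] [MeasurableSpace A] [MeasurableSingletonClass A]
    (μ : PMF X) (ν : PMF F) (u : X → A → F → ℝ) (π₀ π : Policy X F A)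
    (hsupp : ∀ x f a, π₀.prob x f a = 0 → π.prob x f a = 0) :
    ∫ z, weightedUtility u π₀ π z ∂(observationLaw μ ν π₀).toMeasure = netUtility μ ν u π := by
  rw [PMF.integral_eq_sum, Fintype.sum_prod_type]
  simp only [Fintype.sum_prod_type, netUtility, netUtilityInFrame, Finset.mul_sum]
  rw [Finset.sum_comm]
  refine Finset.sum_congr rfl fun f _ => Finset.sum_congr rfl fun x _ =>
    Finset.sum_congr rfl fun a _ => ?_
  rw [observationLaw_apply, ENNReal.toReal_mul, ENNReal.toReal_mul, weightedUtility, smul_eq_mul]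
  change (μ x).toReal * ((ν f).toReal * π₀.prob x f a)
    * (π.prob x f a / π₀.prob x f a * u x a f) = _
  rcases eq_or_ne (π₀.prob x f a) 0 with h | h
  -- Where `π₀` vanishes so does `π`, and both sides are zero with `0 / 0 = 0`.
  · simp [h, hsupp x f a h]
  · field_simp

theorem sampleMean_const_mul {T : ℕ} (M : ℝ) (v : Fin T → ℝ) :
    sampleMean (fun t => M * v t) = M * sampleMean v := by
  simp only [sampleMean, ← Finset.mul_sum]
  ring

theorem sampleVariance_const_mul {T : ℕ} (M : ℝ) (v : Fin T → ℝ) :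
    sampleVariance (fun t => M * v t) = M ^ 2 * sampleVariance v := by
  simp only [sampleVariance, sampleMean_const_mul, ← mul_sub, mul_pow, ← Finset.mul_sum]
  ring

theorem theorem3 {X F A Ω : Type*} [Fintype X] [Fintype F] [Fintype A]
    [MeasurableSpace X] [MeasurableSingletonClass X]
    [MeasurableSpace F] [MeasurableSingletonClass F]
    [MeasurableSpace A] [MeasurableSingletonClass A]
    [MeasurableSpace Ω] (P : Measure Ω) [IsProbabilityMeasure P]
    -- prior of the states, distribution of the frames, utility function, observed policy
    (μ : PMF X) (ν : PMF F) (u : X → A → F → ℝ) (π₀ : Policy X F A)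
    -- the hypothesis class of policies, whose importance weights are well defined
    (H : Set (Policy X F A))
    (hsupp : ∀ π ∈ H, ∀ x f a, π₀.prob x f a = 0 → π.prob x f a = 0)
    -- the normalization constant
    (M : ℝ) (hM : 0 < M)
    (hrange : ∀ g ∈ utilityClass M u π₀ H, ∀ z, g z ∈ Set.Icc (0 : ℝ) 1)
    -- the confidence parameter and the i.i.d. observations
    (γ : ℝ) (hγ : 0 < γ) (hγ' : γ < 1) (T : ℕ) (hT : 16 ≤ T)
    (D : Fin T → Ω → X × F × A)
    (hlaw : ∀ t, HasLaw (D t) (observationLaw μ ν π₀).toMeasure P)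
    (hindep : iIndepFun D P) :
    1 - γ ≤ P.real {ω | ∀ π ∈ H,
      netUtility μ ν u π ≤
        sampleMean (fun t => weightedUtility u π₀ π (D t ω))
          + confidenceCoeff (utilityClass M u π₀ H) T γ
            * √(sampleVariance (fun t => weightedUtility u π₀ π (D t ω)) / T)
          + 15 * confidenceCoeff (utilityClass M u π₀ H) T γ ^ 2 / (18 * M * (T - 1))} := by
  rcases H.eq_empty_or_nonempty with rfl | hH
  · simpa using hγ.le
  have hne : (utilityClass M u π₀ H).Nonempty := hH.elim fun π hπ => ⟨_, π, hπ, rfl⟩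
  set ρ := (observationLaw μ ν π₀).toMeasure
  set c := confidenceCoeff (utilityClass M u π₀ H) T γ with hc
  set B := {x : Fin T → X × F × A | ∃ g ∈ utilityClass M u π₀ H,
    sampleMean (fun i => g (x i)) + c * √(sampleVariance (fun i => g (x i)) / T)
      + 15 * c ^ 2 / (18 * (T - 1)) < ∫ z, g z ∂ρ}
  have hB : (Measure.pi fun _ : Fin T => ρ).real B ≤ γ :=
    measureReal_exists_gt_empirical_bernstein_le ρ hrange hne hγ hγ' (by omega)
  have hD : AEMeasurable (fun ω t => D t ω) P :=
    aemeasurable_pi_lambda _ fun t => (hlaw t).aemeasurable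
  have hmap : P.map (fun ω t => D t ω) = Measure.pi fun _ : Fin T => ρ := by
    rw [(iIndepFun_iff_map_fun_eq_pi_map fun t => (hlaw t).aemeasurable).1 hindep]
    congr 1
    funext t
    exact (hlaw t).map_eq
  have hBc : (Measure.pi fun _ : Fin T => ρ).real Bᶜ
      = P.real {ω | (fun t => D t ω) ∈ Bᶜ} := by
    rw [← hmap, measureReal_def, Measure.map_apply_of_aemeasurable hD .of_discrete]
    rfl
  have hT1 : (0 : ℝ) < T - 1 := by
    have : (16 : ℝ) ≤ T := by exact_mod_cast hT
    linarith
  have hge : 1 - γ ≤ P.real {ω | (fun t => D t ω) ∈ Bᶜ} := by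
    rw [← hBc, probReal_compl_eq_one_sub .of_discrete]
    linarith
  refine hge.trans (measureReal_mono ?_)
  intro ω hω π hπ
  by_contra! hlt
  refine hω ⟨_, ⟨π, hπ, rfl⟩, ?_⟩
  -- Mean and root variance are homogeneous in `M`, and the remainder carries `1 / M`, so
  -- multiplying by `M` turns the violation `hlt` into membership in `B`.
  rw [integral_const_mul, integral_weightedUtility μ ν u π₀ π (hsupp π hπ),
    sampleMean_const_mul, sampleVariance_const_mul, mul_div_assoc, Real.sqrt_mul (sq_nonneg M),
    Real.sqrt_sq hM.le]
  have h := mul_lt_mul_of_pos_left hlt hM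
  refine lt_of_eq_of_lt ?_ h
  field_simp
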